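/- **Notation.** Let $\mathbb H_{\mathbb C}$ be the algebra of complex $2\times2$ matrices $Z=\begin{pmatrix} z_{11}&z_{12}\\ z_{21}&z_{22}\end{pmatrix}$, $N(Z)=\det Z$, $\mathbb H_{\mathbb C}^\times=\{Z: N(Z)\neq 0\}$, and $\square=4\bigl(\frac{\partial^2}{\partial z_{11}\partial z_{22}}-\frac{\partial^2}{\partial z_{12}\partial z_{21}}\bigr)$. All function spaces below are complex vector spaces of functions on $\mathbb H_{\mathbb C}^\times$. Put $Zh^+=\mathbb C[z_{11},z_{12},z_{21},z_{22}]$ and $Zh=\mathbb C[z_{11},z_{12},z_{21},z_{22},N(Z)^{-1}]$. A function is called harmonic if it is holomorphic and annihilated by $\square$. Let $\mathcal H^+$ be the space of harmonic polynomials, let $\mathcal H^-$ be the space of harmonic functions $\varphi$ such that $N(Z)^{-1}\varphi(Z^{-1})\in\mathcal H^+$, and for $m=1,2$ let $$Zh_m^-=\bigl\{f\in Zh:\ N(Z)^{-(m+1)}f(Z^{-1})\in Zh^+\bigr\}.$$ For $l=0,\tfrac12,1,\tfrac32,\dots$ and $m,n\in\{-l,-l+1,\dots,l\}$ let $$t^l_{n\,\underline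 m}(Z)=\frac1{2\pi i}\oint (sz_{11}+z_{21})^{l-m}(sz_{12}+z_{22})^{l+m}s^{-l+n}\,\frac{ds}{s},$$ the integral being over a loop going once counterclockwise around the origin. Define $Zh^0$, $I_2^+$ and $I_2^-$ as the $\mathbb C$-linear spans of the functions $t^l_{n\,\underline m}(Z)\,N(Z)^k$, over all such $l,m,n$ and all $k\in\mathbb Z$ satisfying respectively $-(2l+1)\le k\le -1$, $\ k\ge-(2l+1)$, and $k\le-2$. **Proposition.** Consider the linear multiplication maps determined on pure tensors by $\varphi_1\otimes\varphi_2\otimes\varphi_3\mapsto\varphi_1\varphi_2\varphi_3$ (with each $\varphi_i$ in $\mathcal H^+$ or $\mathcal H^-$) and $\varphi\otimes f\mapsto\varphi f$ (with $\varphi$ in $\mathcal H^+$ or $\mathcal H^-$, and $f$ in $Zh^+$, $Zh_1^-$ or $Zh^0$). 1. The images of $\mathcal H^+\otimes\mathcal H^+\otimes\mathcal H^+$ and $\mathcal H^+\otimes Zh^+$ are both equal to $Zh^+$. 2. The images of $\mathcal H^-\otimes\mathcal H^-\otimes\mathcal H^-$ and $\mathcal H^-\otimes Zh_1^-$ are both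 equal to $Zh_2^-$. 3. The images of $\mathcal H^+\otimes\mathcal H^+\otimes\mathcal H^-$, $\mathcal H^-\otimes Zh^+$ and $\mathcal H^+\otimes Zh^0$ are all equal to $I_2^+$. 4. The images of $\mathcal H^-\otimes\mathcal H^-\otimes\mathcal H^+$, $\mathcal H^+\otimes Zh_1^-$ and $\mathcal H^-\otimes Zh^0$ are all equal to $I_2^-$. -/

import Mathlib

open scoped TensorProduct

noncomputable section

namespace ComplexQuaternion

/-- The group of invertible complexified quaternions, realized as `GL(2, ℂ)`, i.e. the set of
`Z = (z₁₁ z₁₂; z₂₁ z₂₂)` with `N(Z) = det Z ≠ 0`. -/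
abbrev HCx : Type := Matrix.GeneralLinearGroup (Fin 2) ℂ

/-- Complex-valued functions on the set `N(Z) ≠ 0`, with pointwise operations. -/
abbrev Fun : Type := HCx → ℂ

/-- The coordinate function `z_{ij}`. -/
def coord (i j : Fin 2) : Fun := fun Z => (Z : Matrix (Fin 2) (Fin 2) ℂ) i j

/-- The norm `N(Z) = det Z = z₁₁ z₂₂ - z₁₂ z₂₁`. -/
def N : Fun := fun Z => (Z : Matrix (Fin 2) (Fin 2) ℂ).det

/-- Extension by zero from `N(Z) ≠ 0` to all of `ℂ^{2 × 2}`; the set `N(Z) ≠ 0` is open, so the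
derivatives at its points do not depend on the values outside it. -/
def zeroExt (f : Fun) : (Fin 2 → Fin 2 → ℂ) → ℂ := fun Z =>
  if h : (Matrix.of Z).det ≠ 0 then f (Matrix.GeneralLinearGroup.mkOfDetNeZero (Matrix.of Z) h)
  else 0

/-- The open set `N(Z) ≠ 0` in `ℂ^{2 × 2}`. -/
def regularSet : Set (Fin 2 → Fin 2 → ℂ) := {Z | (Matrix.of Z).det ≠ 0}

/-- The partial derivative `∂F/∂z_{ij}`. -/
def partialD (i j : Fin 2) (F : (Fin 2 → Fin 2 → ℂ) → ℂ) : (Fin 2 → Fin 2 → ℂ) → ℂ :=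
  fun Z => fderiv ℂ F Z (Pi.single i (Pi.single j 1))

/-- The complex Laplacian `□ = 4 (∂₁₁ ∂₂₂ - ∂₁₂ ∂₂₁)`. -/
def box (F : (Fin 2 → Fin 2 → ℂ) → ℂ) : (Fin 2 → Fin 2 → ℂ) → ℂ :=
  fun Z => 4 * (partialD 0 0 (partialD 1 1 F) Z - partialD 0 1 (partialD 1 0 F) Z)

theorem partialD_analytic {F : (Fin 2 → Fin 2 → ℂ) → ℂ} (hF : AnalyticOnNhd ℂ F regularSet)
    (i j : Fin 2) : AnalyticOnNhd ℂ (partialD i j F) regularSet := fun Z hZ =>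
  ((ContinuousLinearMap.apply ℂ ℂ
    (Pi.single i (Pi.single j 1) : Fin 2 → Fin 2 → ℂ)).analyticAt _).comp (hF Z hZ).fderiv

theorem regularSet_isOpen : IsOpen regularSet := by
  have h : Continuous fun Z : Fin 2 → Fin 2 → ℂ => (Matrix.of Z).det :=
    Continuous.matrix_det continuous_id
  exact isOpen_ne_fun h continuous_const

theorem partialD_congr {F G : (Fin 2 → Fin 2 → ℂ) → ℂ} (h : Set.EqOn F G regularSet)
    (i j : Fin 2) : Set.EqOn (partialD i j F) (partialD i j G) regularSet := fun Z hZ => by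
  have : F =ᶠ[nhds Z] G := Filter.eventually_of_mem (regularSet_isOpen.mem_nhds hZ) h
  simp only [partialD, this.fderiv_eq]

theorem partialD_add {F G : (Fin 2 → Fin 2 → ℂ) → ℂ} (hF : AnalyticOnNhd ℂ F regularSet)
    (hG : AnalyticOnNhd ℂ G regularSet) (i j : Fin 2) :
    Set.EqOn (partialD i j (F + G)) (partialD i j F + partialD i j G) regularSet := fun Z hZ => by
  simp [partialD, fderiv_add (hF Z hZ).differentiableAt (hG Z hZ).differentiableAt]

theorem partialD_smul {F : (Fin 2 → Fin 2 → ℂ) → ℂ} (hF : AnalyticOnNhd ℂ F regularSet)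
    (c : ℂ) (i j : Fin 2) :
    Set.EqOn (partialD i j (c • F)) (c • partialD i j F) regularSet := fun Z hZ => by
  simp [partialD, fderiv_const_smul (hF Z hZ).differentiableAt]

theorem box_add {F G : (Fin 2 → Fin 2 → ℂ) → ℂ} (hF : AnalyticOnNhd ℂ F regularSet)
    (hG : AnalyticOnNhd ℂ G regularSet) {Z : Fin 2 → Fin 2 → ℂ} (hZ : Z ∈ regularSet) :
    box (F + G) Z = box F Z + box G Z := by
  have key : ∀ i j i' j' : Fin 2, partialD i j (partialD i' j' (F + G)) Z
      = partialD i j (partialD i' j' F) Z + partialD i j (partialD i' j' G) Z :=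
    fun i j i' j' => (partialD_congr (partialD_add hF hG i' j') i j hZ).trans
      (partialD_add (partialD_analytic hF i' j') (partialD_analytic hG i' j') i j hZ)
  simp only [box, key]
  ring

theorem box_smul {F : (Fin 2 → Fin 2 → ℂ) → ℂ} (hF : AnalyticOnNhd ℂ F regularSet) (c : ℂ)
    {Z : Fin 2 → Fin 2 → ℂ} (hZ : Z ∈ regularSet) : box (c • F) Z = c * box F Z := by
  have key : ∀ i j i' j' : Fin 2, partialD i j (partialD i' j' (c • F)) Z
      = c * partialD i j (partialD i' j' F) Z :=
    fun i j i' j' => (partialD_congr (partialD_smul hF c i' j') i j hZ).trans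
      (partialD_smul (partialD_analytic hF i' j') c i j hZ)
  simp only [box, key]
  ring

theorem zeroExt_add (f g : Fun) : zeroExt (f + g) = zeroExt f + zeroExt g := by
  funext Z
  by_cases h : (Matrix.of Z).det ≠ 0 <;> simp [zeroExt, h]

theorem zeroExt_smul (c : ℂ) (f : Fun) : zeroExt (c • f) = c • zeroExt f := by
  funext Z
  by_cases h : (Matrix.of Z).det ≠ 0 <;> simp [zeroExt, h]

/-- The holomorphic functions of `z₁₁, z₁₂, z₂₁, z₂₂` on `N(Z) ≠ 0` annihilated by `□`. -/
def Harm : Submodule ℂ Fun where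
  carrier := {f | AnalyticOnNhd ℂ (zeroExt f) regularSet ∧ ∀ Z ∈ regularSet, box (zeroExt f) Z = 0}
  zero_mem' := by
    have h : zeroExt 0 = 0 := by
      funext Z
      simp [zeroExt]
    refine ⟨by rw [h]; exact analyticOnNhd_const, fun Z hZ => ?_⟩
    have := box_smul (F := 0) analyticOnNhd_const 0 hZ
    rw [h]
    simpa using this
  add_mem' := fun {f g} hf hg => by
    refine ⟨by rw [zeroExt_add]; exact hf.1.add hg.1, fun Z hZ => ?_⟩
    rw [zeroExt_add, box_add hf.1 hg.1 hZ, hf.2 Z hZ, hg.2 Z hZ, add_zero]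
  smul_mem' := fun c f hf => by
    refine ⟨by rw [zeroExt_smul]; exact hf.1.const_smul, fun Z hZ => ?_⟩
    rw [zeroExt_smul, box_smul hf.1 c hZ, hf.2 Z hZ, mul_zero]

/-- The algebra `ℂ[z₁₁, z₁₂, z₂₁, z₂₂]` of polynomial functions. -/
def ZhPoly : Subalgebra ℂ Fun := Algebra.adjoin ℂ (Set.range fun p : Fin 2 × Fin 2 => coord p.1 p.2)

/-- The algebra `ℂ[z₁₁, z₁₂, z₂₁, z₂₂, N(Z)⁻¹]`. -/
def Zh : Subalgebra ℂ Fun :=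
  Algebra.adjoin ℂ ((Set.range fun p : Fin 2 × Fin 2 => coord p.1 p.2) ∪ {N⁻¹})

/-- `Zh⁺`: the space of polynomial functions. -/
def ZhPlus : Submodule ℂ Fun := Subalgebra.toSubmodule ZhPoly

/-- The action of the inversion `(0 1; 1 0)`: `f(Z) ↦ f(Z⁻¹) / N(Z)^(m+1)`. This is the action
`ϖ_m` for `m ≥ 1`, and the action on harmonic functions for `m = 0`. -/
def inversion (m : ℕ) : Fun →ₗ[ℂ] Fun where
  toFun f := fun Z => f Z⁻¹ / N Z ^ (m + 1)
  map_add' f g := by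
    funext Z
    simp [add_div]
  map_smul' c f := by
    funext Z
    simp [mul_div_assoc]

/-- `H⁺`: the harmonic polynomials. -/
def HPlus : Submodule ℂ Fun := Harm ⊓ ZhPlus

/-- `H⁻`: the harmonic functions `φ` regular at infinity, i.e. `N(Z)⁻¹ φ(Z⁻¹) ∈ H⁺`. -/
def HMinus : Submodule ℂ Fun := Harm ⊓ HPlus.comap (inversion 0)

/-- `Zh_m⁻`: the `f ∈ Zh` with `f(Z⁻¹) / N(Z)^(m+1) ∈ Zh⁺`. -/
def ZhMinus (m : ℕ) : Submodule ℂ Fun := Subalgebra.toSubmodule Zh ⊓ ZhPlus.comap (inversion m)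

/-- The matrix coefficient `t^l_{n m}(Z)`, equal to
`(1/2πi) ∮ (s z₁₁ + z₂₁)^(l-m) (s z₁₂ + z₂₂)^(l+m) s^(-l+n) ds/s`. The half-integer indices are
encoded by the natural numbers `L = 2l`, `p = l - n`, `q = l - m`, where `0 ≤ p, q ≤ L`. -/
def t (L : ℕ) (p q : Fin (L + 1)) : Fun := fun Z =>
  (2 * Real.pi * Complex.I)⁻¹ *
    ∮ s in C(0, 1), (s * coord 0 0 Z + coord 1 0 Z) ^ (q : ℕ) *
      (s * coord 0 1 Z + coord 1 1 Z) ^ (L - (q : ℕ)) * s ^ (-(p : ℤ)) / s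

/-- The span of the functions `t^l_{n m}(Z) N(Z)^k` for which `P (2l) k` holds. -/
def spanT (P : ℕ → ℤ → Prop) : Submodule ℂ Fun :=
  Submodule.span ℂ {f | ∃ (L : ℕ) (p q : Fin (L + 1)) (k : ℤ), P L k ∧ f = t L p q * N ^ k}

/-- `Zh⁰`: the span of `t^l_{n m}(Z) N(Z)^k` with `-(2l+1) ≤ k ≤ -1`. -/
def ZhZero : Submodule ℂ Fun := spanT fun L k => -((L : ℤ) + 1) ≤ k ∧ k ≤ -1

/-- `I₂⁺`: the span of `t^l_{n m}(Z) N(Z)^k` with `k ≥ -(2l+1)`. -/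
def I2Plus : Submodule ℂ Fun := spanT fun L k => -((L : ℤ) + 1) ≤ k

/-- `I₂⁻`: the span of `t^l_{n m}(Z) N(Z)^k` with `k ≤ -2`. -/
def I2Minus : Submodule ℂ Fun := spanT fun _ k => k ≤ -2

/-- The multiplication map `A ⊗ B → functions`, `φ ⊗ f ↦ φ f`. -/
def mult₂ (A B : Submodule ℂ Fun) : A ⊗[ℂ] B →ₗ[ℂ] Fun :=
  LinearMap.mul' ℂ Fun ∘ₗ TensorProduct.map A.subtype B.subtype

/-- The multiplication map `A ⊗ B ⊗ C → functions`, `φ₁ ⊗ φ₂ ⊗ φ₃ ↦ φ₁ φ₂ φ₃`. -/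
def mult₃ (A B C : Submodule ℂ Fun) : (A ⊗[ℂ] B) ⊗[ℂ] C →ₗ[ℂ] Fun :=
  LinearMap.mul' ℂ Fun ∘ₗ TensorProduct.map (mult₂ A B) C.subtype

end ComplexQuaternion

end

open ComplexQuaternion

noncomputable section

namespace ComplexQuaternion

/-! The range of a multiplication map is a product of submodules, so each claim is an identity
between such products.

The matrix coefficients are the coefficients in `s` of `(s z₁₁ + z₂₁)^q (s z₁₂ + z₂₂)^r`.
Multiplying one of degree `L` by a coordinate gives degree `L + 1` plus `N` times degree `L - 1`
(`X_mul_tPoly_mem`). Hence the `N^k t` span all polynomials, and the eigenvalues of `N □` on them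
show that the harmonic polynomials are the span of the `t` (`mem_span_tPoly_of_lap_eq_zero`). By
inversion, `H⁻` is the span of the `t N^(-(2l+1))`.

A monomial is a monomial in the first row times one in the second, and both are harmonic; so `H⁺ H⁺
= Zh⁺`. The same coordinate rule makes `I₂⁺` a module over polynomials, which bounds the products in
item 3 from above; explicit factorizations give the converse. Items 2 and 4 follow from 1 and 3 by
inversion: it is an involution whose weights add under products (`map_inversion_mul`), and it
exchanges `H⁺` with `H⁻` and `I₂⁺` with `I₂⁻` while fixing `Zh⁰`. -/

open MvPolynomial

/-! ### Matrix coefficients as coefficients of generating polynomials -/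

/-- Polynomials in the four matrix entries. -/
abbrev Poly : Type := MvPolynomial (Fin 2 × Fin 2) ℂ

/-- The determinant as a polynomial. -/
def detPoly : Poly := X (0, 0) * X (1, 1) - X (0, 1) * X (1, 0)

/-- The operator `∂₁₁ ∂₂₂ - ∂₁₂ ∂₂₁` on polynomials. -/
def lap : Poly →ₗ[ℂ] Poly :=
  (pderiv (0, 0)).toLinearMap ∘ₗ (pderiv (1, 1)).toLinearMap -
    (pderiv (0, 1)).toLinearMap ∘ₗ (pderiv (1, 0)).toLinearMap

theorem lap_apply (f : Poly) :
    lap f = pderiv (0, 0) (pderiv (1, 1) f) - pderiv (0, 1) (pderiv (1, 0) f) := rfl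

/-- The Euler operator. -/
def euler : Derivation ℂ Poly Poly := mkDerivation ℂ X

theorem euler_apply (f : Poly) :
    euler f = X (0, 0) * pderiv (0, 0) f + X (0, 1) * pderiv (0, 1) f
      + X (1, 0) * pderiv (1, 0) f + X (1, 1) * pderiv (1, 1) f := by
  have : euler = (X (0, 0) : Poly) • pderiv (0, 0) + (X (0, 1) : Poly) • pderiv (0, 1)
      + (X (1, 0) : Poly) • pderiv (1, 0) + (X (1, 1) : Poly) • pderiv (1, 1) := by
    refine derivation_ext fun ⟨i, j⟩ => ?_
    fin_cases i <;> fin_cases j <;> simp [euler, mkDerivation_X, pderiv_X]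
  rw [this]
  simp

/-- A derivation acting on the coefficients of a univariate polynomial. -/
def coeffD (D : Derivation ℂ Poly Poly) : Derivation ℂ (Polynomial Poly) (Polynomial Poly) :=
  PolynomialModule.equivPolynomialSelf.compDer D.mapCoeffs

theorem coeff_coeffD (D : Derivation ℂ Poly Poly) (g : Polynomial Poly) (p : ℕ) :
    (coeffD D g).coeff p = D (g.coeff p) := rfl

theorem coeffD_C (D : Derivation ℂ Poly Poly) (f : Poly) :
    coeffD D (Polynomial.C f) = Polynomial.C (D f) := by
  ext1 p
  rw [coeff_coeffD, Polynomial.coeff_C, Polynomial.coeff_C]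
  split_ifs <;> simp

theorem coeffD_X (D : Derivation ℂ Poly Poly) : coeffD D Polynomial.X = 0 := by
  ext1 p
  rw [coeff_coeffD, Polynomial.coeff_X]
  split_ifs <;> simp

/-- The generating polynomial `(s z₁₁ + z₂₁)^q (s z₁₂ + z₂₂)^r`. -/
def gen (q r : ℕ) : Polynomial Poly :=
  (Polynomial.X * Polynomial.C (X (0, 0)) + Polynomial.C (X (1, 0))) ^ q *
    (Polynomial.X * Polynomial.C (X (0, 1)) + Polynomial.C (X (1, 1))) ^ r

/-- The polynomial `t^l_{n m}`. -/
def tPoly (q r p : ℕ) : Poly := (gen q r).coeff p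

/-- The generating polynomial of the adjugate matrix. -/
def genAdj (q r : ℕ) : Polynomial Poly :=
  (Polynomial.X * Polynomial.C (X (1, 1)) - Polynomial.C (X (1, 0))) ^ q *
    (Polynomial.C (X (0, 0)) - Polynomial.X * Polynomial.C (X (0, 1))) ^ r

/-- The composition of `t^l_{n m}` with the adjugate. -/
def tAdj (q r p : ℕ) : Poly := (genAdj q r).coeff p

theorem lap_coeff (g : Polynomial Poly) (p : ℕ) : lap (g.coeff p) =
    (coeffD (pderiv (0, 0)) (coeffD (pderiv (1, 1)) g)
      - coeffD (pderiv (0, 1)) (coeffD (pderiv (1, 0)) g)).coeff p := by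
  simp only [lap_apply, Polynomial.coeff_sub, coeff_coeffD]

theorem lap_tPoly (q r p : ℕ) : lap (tPoly q r p) = 0 := by
  rw [tPoly, lap_coeff, gen]
  simp [Derivation.leibniz, Derivation.leibniz_pow, coeffD_C, coeffD_X, pderiv_X]
  ring_nf

theorem lap_tAdj (q r p : ℕ) : lap (tAdj q r p) = 0 := by
  rw [tAdj, lap_coeff, genAdj]
  simp [Derivation.leibniz, Derivation.leibniz_pow, coeffD_C, coeffD_X, pderiv_X]
  ring_nf

theorem euler_tPoly (q r p : ℕ) : euler (tPoly q r p) = ((q + r : ℕ) : ℂ) • tPoly q r p := by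
  rw [tPoly, ← coeff_coeffD, ← Polynomial.coeff_smul]
  congr 1
  rw [gen]
  rcases q with _ | q <;> rcases r with _ | r <;>
  simp [Derivation.leibniz, Derivation.leibniz_pow, coeffD_C, coeffD_X, euler, mkDerivation_X,
    Algebra.smul_def] <;> ring_nf <;> simp

theorem euler_tAdj (q r p : ℕ) : euler (tAdj q r p) = ((q + r : ℕ) : ℂ) • tAdj q r p := by
  rw [tAdj, ← coeff_coeffD, ← Polynomial.coeff_smul]
  congr 1
  rw [genAdj]
  rcases q with _ | q <;> rcases r with _ | r <;>
  simp [Derivation.leibniz, Derivation.leibniz_pow, coeffD_C, coeffD_X, euler, mkDerivation_X,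
    Algebra.smul_def] <;> ring_nf <;> simp

/-- This is the `sl₂` relation: the commutator of `lap` with multiplication by `N` is the Euler
operator plus 2. What matters later is that the factor never vanishes. -/
theorem lap_detPoly_pow_mul (k : ℕ) {f : Poly} {L : ℕ} (hf : lap f = 0)
    (hE : euler f = (L : ℂ) • f) :
    lap (detPoly ^ (k + 1) * f) = (((k + 1) * (k + 2 + L) : ℕ) : ℂ) • (detPoly ^ k * f) := by
  rw [lap_apply] at *
  rw [euler_apply] at hE
  simp [Derivation.leibniz, Derivation.leibniz_pow, detPoly, pderiv_X, smul_eq_C_mul] at *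
  have h2 : (C 2 : Poly) = 2 := map_ofNat _ 2
  rw [h2]
  rcases k with _ | k
  · simp
    linear_combination (X (0, 0) * X (1, 1) - X (0, 1) * X (1, 0)) * hf + hE
  · simp
    linear_combination (X (0, 0) * X (1, 1) - X (0, 1) * X (1, 0)) ^ (k + 2) * hf +
      ((k : Poly) + 2) * (X (0, 0) * X (1, 1) - X (0, 1) * X (1, 0)) ^ (k + 1) * hE

/-- Differentiate `gen (q + 1) r` in `s` and eliminate `z₁₂` through `N = z₁₁ (s z₁₂ + z₂₂) - z₁₂ (s
z₁₁ + z₂₁)`. The truncated `r - 1` at `r = 0` is harmless because of the factor `r`. -/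
theorem mul_X_tPoly_00 (q r p : ℕ) : ((q + r + 1 : ℕ) : Poly) * (X (0, 0) * tPoly q r p) =
    ((p + 1 : ℕ) : Poly) * tPoly (q + 1) r (p + 1) + (r : Poly) * (detPoly * tPoly q (r - 1) p) := by
  have : (Polynomial.C ((q + r + 1 : ℕ) : Poly)) * (Polynomial.C (X (0, 0)) * gen q r)
    = Polynomial.derivative (gen (q + 1) r)
      + Polynomial.C (r : Poly) * (Polynomial.C detPoly * gen q (r - 1)) := by
    simp only [gen, detPoly]
    cases r with
    | zero => simp [Polynomial.derivative_pow]; ring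
    | succ r => simp [Polynomial.derivative_pow]; ring
  have := congrArg (fun g => g.coeff p) this
  simp only [Polynomial.coeff_C_mul, Polynomial.coeff_add, Polynomial.coeff_derivative] at this
  rw [tPoly, this, tPoly, tPoly]
  push_cast
  ring

theorem mul_X_tPoly_01 (q r p : ℕ) : ((q + r + 1 : ℕ) : Poly) * (X (0, 1) * tPoly q r p) =
    ((p + 1 : ℕ) : Poly) * tPoly q (r + 1) (p + 1) - (q : Poly) * (detPoly * tPoly (q - 1) r p) := by
  have : (Polynomial.C ((q + r + 1 : ℕ) : Poly)) * (Polynomial.C (X (0, 1)) * gen q r)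
    = Polynomial.derivative (gen q (r + 1))
      - Polynomial.C (q : Poly) * (Polynomial.C detPoly * gen (q - 1) r) := by
    simp only [gen, detPoly]
    cases q with
    | zero => simp [Polynomial.derivative_pow]; ring
    | succ r => simp [Polynomial.derivative_pow]; ring
  have := congrArg (fun g => g.coeff p) this
  simp only [Polynomial.coeff_C_mul, Polynomial.coeff_sub, Polynomial.coeff_derivative] at this
  rw [tPoly, this, tPoly, tPoly]
  push_cast
  ring

/-- The span of the polynomials `t^l_{n m}` with `2 l = L`. -/
def homHarm (L : ℤ) : Submodule ℂ Poly :=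
  Submodule.span ℂ {f | ∃ q r p : ℕ, (q + r : ℤ) = L ∧ f = tPoly q r p}

theorem tPoly_mem (q r p : ℕ) : tPoly q r p ∈ homHarm (q + r) :=
  Submodule.subset_span ⟨q, r, p, rfl, rfl⟩

theorem tPoly_mem_of_eq {q r p : ℕ} {L : ℤ} (h : (q + r : ℤ) = L) : tPoly q r p ∈ homHarm L :=
  Submodule.subset_span ⟨q, r, p, h, rfl⟩

/-- Membership is asked only for `n ≠ 0`, since `tPoly q (r - 1) p` has the wrong degree when its
coefficient `r` vanishes. -/
theorem natCast_mul_mem {M : Submodule ℂ Poly} (n : ℕ) {f : Poly} (hf : n ≠ 0 → f ∈ M) :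
    (n : Poly) * f ∈ M := by
  rw [← nsmul_eq_mul]
  rcases eq_or_ne n 0 with rfl | hn
  · simp
  · exact M.nsmul_mem (hf hn) n

theorem mem_of_natCast_mul_mem {M : Submodule ℂ Poly} {n : ℕ} {f : Poly} (hn : n ≠ 0)
    (h : (n : Poly) * f ∈ M) : f ∈ M := by
  rw [← nsmul_eq_mul, ← Nat.cast_smul_eq_nsmul ℂ] at h
  exact (M.smul_mem_iff (Nat.cast_ne_zero.2 hn)).1 h

/-- The target of multiplication by a coordinate. -/
def mulTarget (L : ℤ) : Submodule ℂ Poly :=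
  homHarm (L + 1) ⊔ (homHarm (L - 1)).map (LinearMap.mulLeft ℂ detPoly)

theorem mem_mulTarget_left {L : ℤ} {f : Poly} (h : f ∈ homHarm (L + 1)) : f ∈ mulTarget L :=
  Submodule.mem_sup_left h

theorem mem_mulTarget_right {L : ℤ} {f : Poly} (h : f ∈ homHarm (L - 1)) :
    detPoly * f ∈ mulTarget L :=
  Submodule.mem_sup_right ⟨f, h, rfl⟩

/-- The derivative identities handle the first row. For the second row, compare coefficients in `gen
(q + 1) r = (s z₁₁ + z₂₁) gen q r` and its analogue for the other column. -/
theorem X_mul_tPoly_mem (i : Fin 2 × Fin 2) (q r p : ℕ) :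
    X i * tPoly q r p ∈ mulTarget (q + r) := by
  have h00 : ∀ p, X (0, 0) * tPoly q r p ∈ mulTarget (q + r) := fun p => by
    refine mem_of_natCast_mul_mem (Nat.succ_ne_zero (q + r)) ?_
    rw [mul_X_tPoly_00]
    refine add_mem (natCast_mul_mem _ fun _ => mem_mulTarget_left (tPoly_mem_of_eq (by lia)))
      (natCast_mul_mem _ fun _ => mem_mulTarget_right (tPoly_mem_of_eq (by lia)))
  have h01 : ∀ p, X (0, 1) * tPoly q r p ∈ mulTarget (q + r) := fun p => by
    refine mem_of_natCast_mul_mem (Nat.succ_ne_zero (q + r)) ?_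
    rw [mul_X_tPoly_01]
    refine sub_mem (natCast_mul_mem _ fun _ => mem_mulTarget_left (tPoly_mem_of_eq (by lia)))
      (natCast_mul_mem _ fun _ => mem_mulTarget_right (tPoly_mem_of_eq (by lia)))
  have g0 : gen (q + 1) r = Polynomial.X * (Polynomial.C (X (0, 0)) * gen q r)
      + Polynomial.C (X (1, 0)) * gen q r := by
    simp only [gen]; ring
  have g1 : gen q (r + 1) = Polynomial.X * (Polynomial.C (X (0, 1)) * gen q r)
      + Polynomial.C (X (1, 1)) * gen q r := by
    simp only [gen]; ring
  have m0 : tPoly (q + 1) r p ∈ mulTarget (q + r) :=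
    mem_mulTarget_left (tPoly_mem_of_eq (by lia))
  have m1 : tPoly q (r + 1) p ∈ mulTarget (q + r) :=
    mem_mulTarget_left (tPoly_mem_of_eq (by lia))
  rw [tPoly, g0] at m0
  rw [tPoly, g1] at m1
  match i with
  | (0, 0) => exact h00 p
  | (0, 1) => exact h01 p
  | (1, 0) =>
    rcases p with _ | p
    · simpa [tPoly] using m0
    · simp only [Polynomial.coeff_add, Polynomial.coeff_X_mul, Polynomial.coeff_C_mul] at m0
      exact (add_mem_cancel_left (h00 p)).1 m0
  | (1, 1) =>
    rcases p with _ | p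
    · simpa [tPoly] using m1
    · simp only [Polynomial.coeff_add, Polynomial.coeff_X_mul, Polynomial.coeff_C_mul] at m1
      exact (add_mem_cancel_left (h01 p)).1 m1

theorem tPoly_zero : tPoly 0 0 0 = 1 := by simp [tPoly, gen]

/-! ### Decomposition of polynomials and of harmonic polynomials -/

theorem mem_span_det_pow_mul_tPoly (f : Poly) :
    f ∈ Submodule.span ℂ {g | ∃ k q r p : ℕ, g = detPoly ^ k * tPoly q r p} := by
  set D := Submodule.span ℂ {g | ∃ k q r p : ℕ, g = detPoly ^ k * tPoly q r p}
  have hV : ∀ (k : ℕ) (L : ℤ), homHarm L ≤ D.comap (LinearMap.mulLeft ℂ (detPoly ^ k)) :=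
    fun k L => Submodule.span_le.2 <| by
      rintro _ ⟨q, r, p, -, rfl⟩
      exact Submodule.subset_span ⟨k, q, r, p, rfl⟩
  have hT : ∀ (k : ℕ) (L : ℤ), mulTarget L ≤ D.comap (LinearMap.mulLeft ℂ (detPoly ^ k)) :=
    fun k L => sup_le (hV k _) <| Submodule.map_le_iff_le_comap.2 fun f hf => by
      have := hV (k + 1) _ hf
      simpa [pow_succ, mul_assoc] using this
  have hX : ∀ i, D ≤ D.comap (LinearMap.mulLeft ℂ (X i)) := fun i => Submodule.span_le.2 <| by
    rintro _ ⟨k, q, r, p, rfl⟩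
    have := hT k _ (X_mul_tPoly_mem i q r p)
    simpa [mul_left_comm] using this
  have h1 : (1 : Poly) ∈ D := Submodule.subset_span ⟨0, 0, 0, 0, by simp [tPoly_zero]⟩
  induction f using MvPolynomial.induction_on with
  | C a => simpa [Algebra.smul_def] using D.smul_mem a h1
  | add f g hf hg => exact add_mem hf hg
  | mul_X f i hf => rw [mul_comm]; exact hX i hf

/-- Each `N^(k+1) t` is an eigenvector of `N □` (up to scale) with nonzero eigenvalue, while the `t`
lie in the kernel. Independence of eigenspaces kills the nonzero part of a harmonic polynomial. -/
theorem mem_span_tPoly_of_lap_eq_zero {f : Poly} (hf : lap f = 0) :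
    f ∈ Submodule.span ℂ {g | ∃ q r p : ℕ, g = tPoly q r p} := by
  set H := Submodule.span ℂ {g | ∃ q r p : ℕ, g = tPoly q r p}
  let A : Module.End ℂ Poly := LinearMap.mulLeft ℂ detPoly ∘ₗ lap
  have hH : H ≤ LinearMap.ker lap := Submodule.span_le.2 <| by
    rintro _ ⟨q, r, p, rfl⟩
    exact lap_tPoly q r p
  have hle : (⊤ : Submodule ℂ Poly) ≤ H ⊔ ⨆ μ ≠ 0, A.eigenspace μ := by
    intro f _
    refine Submodule.span_le.2 ?_ (mem_span_det_pow_mul_tPoly f)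
    rintro _ ⟨k, q, r, p, rfl⟩
    rcases k with _ | k
    · exact Submodule.mem_sup_left (Submodule.subset_span ⟨q, r, p, by simp⟩)
    · refine Submodule.mem_sup_right (Submodule.mem_iSup_of_mem
        (((k + 1) * (k + 2 + (q + r : ℕ)) : ℕ) : ℂ) (Submodule.mem_iSup_of_mem
          (Nat.cast_ne_zero.2 (by positivity)) (Module.End.mem_eigenspace_iff.2 ?_)))
      change detPoly * lap _ = _
      rw [lap_detPoly_pow_mul k (lap_tPoly q r p) (euler_tPoly q r p), mul_smul_comm, pow_succ']
      ring_nf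
  obtain ⟨h, hh, g, hg, rfl⟩ := Submodule.mem_sup.1 (hle (Submodule.mem_top (x := f)))
  have hg0 : g ∈ A.eigenspace 0 := by
    rw [Module.End.mem_eigenspace_iff]
    rw [map_add, LinearMap.mem_ker.1 (hH hh), zero_add] at hf
    simp [A, hf]
  rwa [Submodule.disjoint_def.1 (A.eigenspaces_iSupIndep 0) g hg0 hg, add_zero]

/-- The same eigenspace argument, now for the Euler operator. It identifies `tAdj` as a combination
of `t` of the same degree without computing coefficients. -/
theorem mem_homHarm {f : Poly} {L : ℕ} (hf : lap f = 0) (hE : euler f = (L : ℂ) • f) :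
    f ∈ homHarm L := by
  let A : Module.End ℂ Poly := euler.toLinearMap
  have hle : Submodule.span ℂ {g | ∃ q r p : ℕ, g = tPoly q r p} ≤
      homHarm L ⊔ ⨆ μ ≠ (L : ℂ), A.eigenspace μ := Submodule.span_le.2 <| by
    rintro _ ⟨q, r, p, rfl⟩
    by_cases h : q + r = L
    · exact Submodule.mem_sup_left (tPoly_mem_of_eq (by lia))
    · exact Submodule.mem_sup_right (Submodule.mem_iSup_of_mem ((q + r : ℕ) : ℂ)
        (Submodule.mem_iSup_of_mem (Nat.cast_injective.ne h)
          (Module.End.mem_eigenspace_iff.2 (euler_tPoly q r p))))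
  have hL : homHarm L ≤ A.eigenspace (L : ℂ) := Submodule.span_le.2 <| by
    rintro _ ⟨q, r, p, h, rfl⟩
    obtain rfl : q + r = L := by lia
    exact Module.End.mem_eigenspace_iff.2 (euler_tPoly q r p)
  obtain ⟨h, hh, g, hg, rfl⟩ := Submodule.mem_sup.1 (hle (mem_span_tPoly_of_lap_eq_zero hf))
  have hg0 : g ∈ A.eigenspace (L : ℂ) :=
    (add_mem_cancel_left (hL hh)).1 (Module.End.mem_eigenspace_iff.2 hE)
  rwa [Submodule.disjoint_def.1 (A.eigenspaces_iSupIndep _) g hg0 hg, add_zero]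

theorem tAdj_mem (q r p : ℕ) : tAdj q r p ∈ homHarm (q + r) := by
  simpa using mem_homHarm (lap_tAdj q r p) (euler_tAdj q r p)

/-! ### Polynomial functions and an algebraic criterion for harmonicity -/

/-- The polynomial function on invertible matrices attached to a polynomial. -/
def ev : Poly →ₐ[ℂ] Fun := aeval fun i : Fin 2 × Fin 2 => coord i.1 i.2

theorem ev_apply (f : Poly) (Z : HCx) :
    ev f Z = eval (fun i : Fin 2 × Fin 2 => coord i.1 i.2 Z) f := by
  induction f using MvPolynomial.induction_on with
  | C a => simp [ev]
  | add f g hf hg => simp [hf, hg]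
  | mul_X f i hf => rw [map_mul, map_mul, Pi.mul_apply, hf]; simp [ev]

theorem ev_X (i : Fin 2 × Fin 2) : ev (X i) = coord i.1 i.2 := by simp [ev]

theorem N_ne_zero (Z : HCx) : N Z ≠ 0 :=
  ((Matrix.isUnit_iff_isUnit_det _).1 Z.isUnit).ne_zero

theorem ev_detPoly : ev detPoly = N := by
  funext Z
  simp [detPoly, ev_X, N, coord, Matrix.det_fin_two]

theorem ZhPlus_eq_range : ZhPlus = LinearMap.range ev.toLinearMap := by
  rw [ZhPlus, ZhPoly, Algebra.adjoin_range_eq_range_aeval]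
  rfl

theorem ev_mem_ZhPlus (f : Poly) : ev f ∈ ZhPlus := by
  rw [ZhPlus_eq_range]
  exact ⟨f, rfl⟩

theorem detPoly_ne_zero : detPoly ≠ 0 := fun h => by
  have := congrArg ev h
  rw [ev_detPoly, map_zero] at this
  exact N_ne_zero 1 (congrFun this 1)

theorem eq_zero_of_forall_regularSet {f : Poly}
    (h : ∀ Z ∈ regularSet, eval (fun i : Fin 2 × Fin 2 => Z i.1 i.2) f = 0) : f = 0 := by
  -- The factor `detPoly` vanishes off the regular set, so the product vanishes everywhere.
  refine (mul_eq_zero.1 (MvPolynomial.funext (q := 0) fun x => ?_ : f * detPoly = 0)).resolve_right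
    detPoly_ne_zero
  rw [map_mul, map_zero]
  by_cases hx : (fun i j => x (i, j)) ∈ regularSet
  · rw [show x = fun i : Fin 2 × Fin 2 => (fun i j => x (i, j)) i.1 i.2 from rfl, h _ hx, zero_mul]
  · have : eval x detPoly = 0 := by
      simpa [regularSet, Matrix.det_fin_two, detPoly] using hx
    rw [this, mul_zero]

/-- The function `f / N ^ m` on `ℂ^{2 × 2}`. -/
def frac (f : Poly) (m : ℕ) : (Fin 2 → Fin 2 → ℂ) → ℂ := fun Z =>
  eval (fun i : Fin 2 × Fin 2 => Z i.1 i.2) f / eval (fun i : Fin 2 × Fin 2 => Z i.1 i.2) detPoly ^ m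

theorem eval_detPoly_ne_zero {Z : Fin 2 → Fin 2 → ℂ} (hZ : Z ∈ regularSet) :
    eval (fun i : Fin 2 × Fin 2 => Z i.1 i.2) detPoly ≠ 0 := by
  simpa [regularSet, Matrix.det_fin_two, detPoly] using hZ

theorem zeroExt_eqOn_frac (f : Poly) (m : ℕ) :
    Set.EqOn (zeroExt (ev f / N ^ m)) (frac f m) regularSet := fun Z hZ => by
  have hZ' : (Matrix.of Z).det ≠ 0 := hZ
  rw [zeroExt, dif_pos hZ', ← ev_detPoly]
  simp only [Pi.div_apply, Pi.pow_apply, ev_apply]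
  rfl

theorem analyticAt_eval (f : Poly) (Z : Fin 2 → Fin 2 → ℂ) :
    AnalyticAt ℂ (fun Z : Fin 2 → Fin 2 → ℂ => eval (fun i : Fin 2 × Fin 2 => Z i.1 i.2) f) Z := by
  refine AnalyticAt.aeval_mvPolynomial (f := fun (Z : Fin 2 → Fin 2 → ℂ) (i : Fin 2 × Fin 2) =>
    Z i.1 i.2) (fun i => ?_) f
  exact ((ContinuousLinearMap.proj i.2).comp
    (ContinuousLinearMap.proj (R := ℂ) (φ := fun _ : Fin 2 => Fin 2 → ℂ) i.1)).analyticAt Z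

theorem analyticAt_frac (f : Poly) (m : ℕ) : AnalyticOnNhd ℂ (frac f m) regularSet := fun Z hZ =>
  (analyticAt_eval f Z).div ((analyticAt_eval detPoly Z).pow m)
    (pow_ne_zero _ (eval_detPoly_ne_zero hZ))

theorem partialD_eval (i j : Fin 2) (f : Poly) (Z : Fin 2 → Fin 2 → ℂ) :
    partialD i j (fun Z => eval (fun i : Fin 2 × Fin 2 => Z i.1 i.2) f) Z
      = eval (fun i : Fin 2 × Fin 2 => Z i.1 i.2) (pderiv (i, j) f) := by
  induction f using MvPolynomial.induction_on with
  | C a => simp [partialD]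
  | add f g hf hg =>
    simp only [partialD, map_add] at *
    rw [fderiv_fun_add (analyticAt_eval f Z).differentiableAt (analyticAt_eval g Z).differentiableAt]
    simp [hf, hg]
  | mul_X f k hf =>
    have hk : HasFDerivAt (fun Z : Fin 2 → Fin 2 → ℂ => Z k.1 k.2)
        ((ContinuousLinearMap.proj k.2).comp
          (ContinuousLinearMap.proj (R := ℂ) (φ := fun _ : Fin 2 => Fin 2 → ℂ) k.1)) Z :=
      ((ContinuousLinearMap.proj k.2).comp
        (ContinuousLinearMap.proj (R := ℂ) (φ := fun _ : Fin 2 => Fin 2 → ℂ) k.1)).hasFDerivAt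
    simp only [partialD, map_mul, eval_X] at *
    rw [((analyticAt_eval f Z).differentiableAt.hasFDerivAt.fun_mul hk).fderiv]
    obtain ⟨k, l⟩ := k
    simp [hf, Derivation.leibniz, pderiv_X, Pi.single_apply, Prod.ext_iff]
    by_cases hki : k = i <;> by_cases hlj : l = j <;> simp [hki, hlj]

theorem partialD_frac (i j : Fin 2) (f : Poly) (m : ℕ) : Set.EqOn (partialD i j (frac f m))
    (frac (detPoly * pderiv (i, j) f - (m : Poly) * f * pderiv (i, j) detPoly) (m + 1))
    regularSet := fun Z hZ => by
  have h0 := eval_detPoly_ne_zero hZ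
  have e1 := partialD_eval i j f Z
  have e2 := partialD_eval i j detPoly Z
  simp only [partialD, frac] at *
  have hf := (analyticAt_eval f Z).differentiableAt.hasFDerivAt
  have hd := (analyticAt_eval detPoly Z).differentiableAt.hasFDerivAt
  have hdi := (hasDerivAt_inv (pow_ne_zero m h0)).comp_hasFDerivAt Z (hd.pow m)
  simp only [div_eq_mul_inv]
  erw [(hf.mul hdi).fderiv]
  simp [e1, e2]
  rcases m with _ | m
  · simp; field_simp
  · simp; field_simp; ring

theorem box_zeroExt (f : Poly) (m : ℕ) {Z : Fin 2 → Fin 2 → ℂ} (hZ : Z ∈ regularSet) :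
    box (zeroExt (ev f / N ^ m)) Z = 4 * frac (detPoly * (detPoly * lap f)
      - (m : Poly) * detPoly * (euler f - (m : Poly) * f + f)) (m + 2) Z := by
  have key : ∀ i j i' j' : Fin 2, partialD i j (partialD i' j' (zeroExt (ev f / N ^ m))) Z = _ :=
    fun i j i' j' => (partialD_congr ((partialD_congr (zeroExt_eqOn_frac f m) i' j').trans
      (partialD_frac i' j' f m)) i j hZ).trans (partialD_frac i j _ _ hZ)
  simp only [box, key]
  have hs : ∀ (g h : Poly) (m : ℕ), frac g m Z - frac h m Z = frac (g - h) m Z := fun g h m => by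
    simp only [frac, map_sub, sub_div]
  rw [hs]
  congr 2
  rw [lap_apply, euler_apply]
  simp [Derivation.leibniz, detPoly, pderiv_X]
  ring

/-- For `f` harmonic of degree `L` the condition reads `m (L - m + 1) f = 0`, which singles out the
exponents `m = 0` and `m = L + 1` of `H⁺` and `H⁻`. -/
theorem ev_div_mem_Harm_iff (f : Poly) (m : ℕ) : ev f / N ^ m ∈ Harm ↔
    detPoly * lap f = (m : Poly) * (euler f - (m : Poly) * f + f) := by
  have hA : AnalyticOnNhd ℂ (zeroExt (ev f / N ^ m)) regularSet :=
    (analyticAt_frac f m).congr regularSet_isOpen (zeroExt_eqOn_frac f m).symm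
  change (_ ∧ _) ↔ _
  rw [and_iff_right hA, ← sub_eq_zero]
  constructor
  · intro h
    refine eq_zero_of_forall_regularSet fun Z hZ => ?_
    have := h Z hZ
    rw [box_zeroExt f m hZ, frac, mul_eq_zero, or_iff_right (by norm_num), div_eq_zero_iff,
      or_iff_left (pow_ne_zero _ (eval_detPoly_ne_zero hZ)), mul_right_comm, mul_comm _ detPoly,
      ← mul_sub, map_mul] at this
    exact (mul_eq_zero.1 this).resolve_left (eval_detPoly_ne_zero hZ)
  · intro h Z hZ
    rw [box_zeroExt f m hZ, mul_right_comm, mul_comm _ detPoly, ← mul_sub, h]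
    simp [frac]

theorem ev_mem_Harm_iff (f : Poly) : ev f ∈ Harm ↔ lap f = 0 := by
  have := ev_div_mem_Harm_iff f 0
  simpa [detPoly_ne_zero] using this

theorem ev_mem_HPlus_iff (f : Poly) : ev f ∈ HPlus ↔ lap f = 0 := by
  rw [HPlus, Submodule.mem_inf, ev_mem_Harm_iff, and_iff_left (ev_mem_ZhPlus f)]

/-! ### The contour integral as a coefficient -/

theorem circleIntegral_zpow (n : ℤ) :
    (∮ s in C(0, 1), s ^ n) = if n = -1 then 2 * Real.pi * Complex.I else 0 := by
  split_ifs with h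
  · subst h
    have := circleIntegral.integral_sub_center_inv 0 (one_ne_zero (α := ℝ))
    simpa [zpow_neg_one] using this
  · simpa using circleIntegral.integral_sub_zpow_of_ne h 0 0 1

theorem circleIntegral_coeff (P : Polynomial ℂ) (p : ℕ) :
    (2 * Real.pi * Complex.I)⁻¹ * (∮ s in C(0, 1), P.eval s * s ^ (-(p : ℤ)) / s) = P.coeff p := by
  -- The extra `p` in the range ensures that the index `p` occurs even beyond the degree of `P`.
  have e : (∮ s in C(0, 1), P.eval s * s ^ (-(p : ℤ)) / s)
      = ∮ s in C(0, 1), ∑ k ∈ Finset.range (P.natDegree + 1 + p), P.coeff k * s ^ ((k : ℤ) - p - 1) := by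
    refine circleIntegral.integral_congr zero_le_one fun s hs => ?_
    have hs0 : s ≠ 0 := by
      rintro rfl
      simp at hs
    rw [Polynomial.eval_eq_sum_range' (n := P.natDegree + 1 + p) (by lia), Finset.sum_mul,
      Finset.sum_div]
    refine Finset.sum_congr rfl fun k _ => ?_
    rw [zpow_sub₀ hs0, zpow_sub₀ hs0, zpow_natCast, zpow_neg, zpow_one]
    ring
  rw [e, circleIntegral.integral_fun_sum]
  · simp only [circleIntegral.integral_const_mul, circleIntegral_zpow]
    rw [Finset.sum_eq_single p]
    · have : (2 * Real.pi * Complex.I : ℂ) ≠ 0 := by simp [Real.pi_ne_zero]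
      rw [if_pos (by lia), mul_left_comm, inv_mul_cancel₀ this, mul_one]
    · intro k _ hk
      rw [if_neg (by lia), mul_zero]
    · intro h
      simp at h
  · intro k _
    refine ContinuousOn.circleIntegrable zero_le_one (continuousOn_const.mul ?_)
    refine continuousOn_id.zpow₀ _ fun s hs => Or.inl ?_
    rintro rfl
    simp at hs

theorem ev_tPoly_apply (q r p : ℕ) (Z : HCx) : ev (tPoly q r p) Z =
    ((Polynomial.X * Polynomial.C (coord 0 0 Z) + Polynomial.C (coord 1 0 Z)) ^ q *
      (Polynomial.X * Polynomial.C (coord 0 1 Z) + Polynomial.C (coord 1 1 Z)) ^ r).coeff p := by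
  rw [ev_apply, tPoly, ← Polynomial.coeff_map, gen]
  simp

theorem ev_tAdj_apply (q r p : ℕ) (Z : HCx) : ev (tAdj q r p) Z =
    ((Polynomial.X * Polynomial.C (coord 1 1 Z) - Polynomial.C (coord 1 0 Z)) ^ q *
      (Polynomial.C (coord 0 0 Z) - Polynomial.X * Polynomial.C (coord 0 1 Z)) ^ r).coeff p := by
  rw [ev_apply, tAdj, ← Polynomial.coeff_map, genAdj]
  simp

theorem t_eq_ev (L : ℕ) (p q : Fin (L + 1)) : t L p q = ev (tPoly q (L - q) p) := by
  funext Z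
  rw [ev_tPoly_apply, ← circleIntegral_coeff]
  simp [t, mul_comm _ (coord _ _ Z)]

theorem tPoly_eq_zero {q r p : ℕ} (h : q + r < p) : tPoly q r p = 0 := by
  refine Polynomial.coeff_eq_zero_of_natDegree_lt (lt_of_le_of_lt ?_ h)
  rw [gen]
  compute_degree

/-! ### Inversion -/

theorem N_inv (Z : HCx) : N Z⁻¹ = (N Z)⁻¹ := by
  refine eq_inv_of_mul_eq_one_left ?_
  rw [N, N, ← Matrix.det_mul, Units.inv_mul, Matrix.det_one]

theorem coord_inv (i j : Fin 2) (Z : HCx) :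
    coord i j Z⁻¹ = (N Z)⁻¹ * (Z : Matrix (Fin 2) (Fin 2) ℂ).adjugate i j := by
  simp [coord, N, Matrix.inv_def]

theorem ev_tPoly_inv (q r p : ℕ) (Z : HCx) :
    ev (tPoly q r p) Z⁻¹ = ev (tAdj q r p) Z * (N Z ^ (q + r))⁻¹ := by
  rw [ev_tPoly_apply, ev_tAdj_apply, mul_comm _ (N Z ^ (q + r))⁻¹, ← Polynomial.coeff_C_mul]
  congr 1
  simp only [coord_inv, Matrix.adjugate_fin_two]
  simp [coord]
  rw [pow_add, mul_inv]
  simp only [← inv_pow, map_mul, map_pow]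
  have e1 : (Polynomial.X * (Polynomial.C (N Z)⁻¹ * Polynomial.C (Z 1 1))
    + -(Polynomial.C (N Z)⁻¹ * Polynomial.C (Z 1 0))) = Polynomial.C (N Z)⁻¹ *
      (Polynomial.X * Polynomial.C (Z 1 1) - Polynomial.C (Z 1 0)) := by ring
  have e2 : (-(Polynomial.X * (Polynomial.C (N Z)⁻¹ * Polynomial.C (Z 0 1)))
    + (Polynomial.C (N Z)⁻¹ * Polynomial.C (Z 0 0))) = Polynomial.C (N Z)⁻¹ *
      (Polynomial.C (Z 0 0) - Polynomial.X * Polynomial.C (Z 0 1)) := by ring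
  rw [e1, e2, mul_pow, mul_pow]
  ring

theorem N_zpow_apply (k : ℤ) (Z : HCx) : (N ^ k) Z = N Z ^ k := rfl

theorem N_zpow_add (k l : ℤ) : N ^ (k + l) = N ^ k * N ^ l := by
  funext Z
  exact zpow_add₀ (N_ne_zero Z) k l

theorem spanT_le {P : ℕ → ℤ → Prop} {M : Submodule ℂ Fun}
    (h : ∀ (q r p : ℕ) (k : ℤ), P (q + r) k → ev (tPoly q r p) * N ^ k ∈ M) : spanT P ≤ M :=
  Submodule.span_le.2 <| by
    rintro _ ⟨L, p, q, k, hP, rfl⟩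
    rw [t_eq_ev]
    exact h _ _ _ _ (by rwa [Nat.add_sub_cancel' (Nat.lt_succ_iff.1 q.2)])

theorem ev_mul_zpow_mem_spanT {P : ℕ → ℤ → Prop} {L : ℤ} {f : Poly} (hf : f ∈ homHarm L) {k : ℤ}
    (hP : ∀ l : ℕ, (l : ℤ) = L → P l k) : ev f * N ^ k ∈ spanT P := by
  suffices homHarm L ≤ (spanT P).comap (LinearMap.mulRight ℂ (N ^ k) ∘ₗ ev.toLinearMap) from this hf
  refine Submodule.span_le.2 ?_
  rintro _ ⟨q, r, p, h, rfl⟩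
  change ev (tPoly q r p) * N ^ k ∈ spanT P
  by_cases hp : q + r < p
  · rw [tPoly_eq_zero hp, map_zero, zero_mul]
    exact zero_mem _
  · refine Submodule.subset_span ⟨q + r, ⟨p, by lia⟩, ⟨q, by lia⟩, k, hP _ (by lia), ?_⟩
    rw [t_eq_ev]
    simp

theorem inversion_apply (m : ℕ) (f : Fun) (Z : HCx) : inversion m f Z = f Z⁻¹ / N Z ^ (m + 1) := rfl

theorem inversion_inversion (m : ℕ) (f : Fun) : inversion m (inversion m f) = f := by
  funext Z
  have := N_ne_zero Z
  rw [inversion_apply, inversion_apply, inv_inv, N_inv, inv_pow]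
  field_simp

theorem inversion_mul (m n : ℕ) (f g : Fun) :
    inversion (m + n + 1) (f * g) = inversion m f * inversion n g := by
  funext Z
  simp only [inversion_apply, Pi.mul_apply]
  rw [div_mul_div_comm, ← pow_add]
  ring_nf

theorem map_inversion_map (m : ℕ) (M : Submodule ℂ Fun) :
    (M.map (inversion m)).map (inversion m) = M := by
  rw [← Submodule.map_comp]
  convert Submodule.map_id M
  ext1 f
  exact inversion_inversion m f

theorem map_inversion_mul (m n : ℕ) (A B : Submodule ℂ Fun) :
    (A * B).map (inversion (m + n + 1)) = A.map (inversion m) * B.map (inversion n) := by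
  apply le_antisymm
  · rw [Submodule.map_le_iff_le_comap, Submodule.mul_le]
    intro f hf g hg
    rw [Submodule.mem_comap, inversion_mul]
    exact Submodule.mul_mem_mul ⟨f, hf, rfl⟩ ⟨g, hg, rfl⟩
  · rw [Submodule.mul_le]
    rintro _ ⟨f, hf, rfl⟩ _ ⟨g, hg, rfl⟩
    exact ⟨f * g, Submodule.mul_mem_mul hf hg, inversion_mul m n f g⟩

theorem inversion_ev_tPoly_mul_zpow (m q r p : ℕ) (k : ℤ) :
    inversion m (ev (tPoly q r p) * N ^ k) = ev (tAdj q r p) * N ^ (-(q + r : ℤ) - k - (m + 1)) := by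
  funext Z
  have h0 := N_ne_zero Z
  rw [inversion_apply, Pi.mul_apply, Pi.mul_apply, N_zpow_apply, N_zpow_apply, N_inv, ev_tPoly_inv,
    zpow_sub₀ h0, zpow_sub₀ h0, zpow_neg, inv_zpow]
  norm_cast
  field_simp

theorem map_inversion_spanT_le (m : ℕ) {P P' : ℕ → ℤ → Prop}
    (h : ∀ L k, P L k → P' L (-L - k - (m + 1))) :
    (spanT P).map (inversion m) ≤ spanT P' := by
  rw [Submodule.map_le_iff_le_comap]
  refine spanT_le fun q r p k hP => ?_
  rw [Submodule.mem_comap, inversion_ev_tPoly_mul_zpow]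
  refine ev_mul_zpow_mem_spanT (tAdj_mem q r p) fun l hl => ?_
  obtain rfl : l = q + r := by lia
  simpa using h _ _ hP

/-- Inversion reflects the exponent of `N` and keeps the degree `L`. Both are involutive, so one
inclusion yields the other. -/
theorem map_inversion_spanT (m : ℕ) {P P' : ℕ → ℤ → Prop}
    (h : ∀ L k, P' L k ↔ P L (-L - k - (m + 1))) :
    (spanT P).map (inversion m) = spanT P' := by
  refine le_antisymm (map_inversion_spanT_le m fun L k hP => (h _ _).2 (by ring_nf; exact hP)) ?_
  rw [← map_inversion_map m (spanT P')]
  exact Submodule.map_mono (map_inversion_spanT_le m fun L k hP => (h _ _).1 hP)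

theorem map_inversion_ZhZero : ZhZero.map (inversion 1) = ZhZero :=
  map_inversion_spanT 1 fun L k => by push_cast; lia

theorem map_inversion_I2Plus : I2Plus.map (inversion 2) = I2Minus :=
  map_inversion_spanT 2 fun L k => by push_cast; lia

/-! ### The spaces as spans or as images under inversion -/

theorem HPlus_eq_spanT : HPlus = spanT fun _ k => k = 0 := by
  apply le_antisymm
  · intro f hf
    have h := hf.2
    rw [ZhPlus_eq_range] at h
    obtain ⟨g, rfl⟩ := h
    change ev g ∈ _
    have hg := mem_span_tPoly_of_lap_eq_zero ((ev_mem_HPlus_iff g).1 hf)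
    refine (Submodule.span_le.2 ?_ :
      _ ≤ (spanT fun _ k => k = 0).comap ev.toLinearMap) hg
    rintro _ ⟨q, r, p, rfl⟩
    have := ev_mul_zpow_mem_spanT (P := fun _ k => k = 0) (tPoly_mem q r p) (k := 0)
      fun _ _ => rfl
    simpa using this
  · refine spanT_le ?_
    rintro q r p k rfl
    rw [zpow_zero, mul_one]
    exact (ev_mem_HPlus_iff _).2 (lap_tPoly q r p)

theorem map_inversion_HPlus_eq_spanT :
    HPlus.map (inversion 0) = spanT fun L k => k = -((L : ℤ) + 1) := by
  rw [HPlus_eq_spanT]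
  exact map_inversion_spanT 0 fun L k => by push_cast; lia

theorem HMinus_eq_map : HMinus = HPlus.map (inversion 0) := by
  apply le_antisymm
  · exact fun f hf => ⟨_, hf.2, inversion_inversion 0 f⟩
  · refine le_inf ?_ ?_
    · rw [map_inversion_HPlus_eq_spanT]
      refine spanT_le ?_
      rintro q r p k rfl
      have : N ^ (-(((q + r : ℕ) : ℤ) + 1)) = (N ^ (q + r + 1))⁻¹ := by
        rw [zpow_neg]; norm_cast
      rw [this, ← div_eq_mul_inv, ev_div_mem_Harm_iff, lap_tPoly, euler_tPoly, smul_eq_C_mul]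
      simp
      ring_nf
      simp
    · rintro _ ⟨f, hf, rfl⟩
      rwa [Submodule.mem_comap, inversion_inversion]

theorem HMinus_eq_spanT : HMinus = spanT fun L k => k = -((L : ℤ) + 1) := by
  rw [HMinus_eq_map, map_inversion_HPlus_eq_spanT]

theorem map_inversion_HMinus : HMinus.map (inversion 0) = HPlus := by
  rw [HMinus_eq_map, map_inversion_map]

/-- The entries of `Z⁻¹` are signed coordinates divided by `N`. Hence membership in `Zh` is
automatic in the definition of `ZhMinus`. -/
theorem inversion_ev_mem_Zh (m : ℕ) (f : Poly) : inversion m (ev f) ∈ Zh := by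
  have hN : N⁻¹ ∈ Zh := Algebra.subset_adjoin (Or.inr rfl)
  have hc : ∀ i j, coord i j ∈ Zh := fun i j => Algebra.subset_adjoin (Or.inl ⟨(i, j), rfl⟩)
  have hi : ∀ i j, (fun Z => coord i j Z⁻¹) ∈ Zh := fun i j => by
    have h : (fun Z => coord i j Z⁻¹) = N⁻¹ *
        fun Z => !![coord 1 1 Z, -coord 0 1 Z; -coord 1 0 Z, coord 0 0 Z] i j := by
      funext Z
      rw [coord_inv, Matrix.adjugate_fin_two]
      rfl
    rw [h]
    refine mul_mem hN ?_
    fin_cases i <;> fin_cases j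
    · exact hc 1 1
    · exact neg_mem (hc 0 1)
    · exact neg_mem (hc 1 0)
    · exact hc 0 0
  have he : (fun Z => ev f Z⁻¹) ∈ Zh := by
    induction f using MvPolynomial.induction_on with
    | C a => 
      have h : (fun Z => ev (C a) Z⁻¹) = algebraMap ℂ Fun a := by
        funext Z
        simp [ev]
      exact h ▸ Zh.algebraMap_mem a
    | add f g hf hg => rw [map_add]; exact add_mem hf hg
    | mul_X f i hf =>
      rw [map_mul, ev_X]
      exact mul_mem hf (hi i.1 i.2)
  have : inversion m (ev f) = (fun Z => ev f Z⁻¹) * N⁻¹ ^ (m + 1) := by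
    funext Z
    simp [inversion_apply, div_eq_mul_inv]
  rw [this]
  exact mul_mem he (pow_mem hN _)

theorem ZhMinus_eq_map (m : ℕ) : ZhMinus m = ZhPlus.map (inversion m) := by
  apply le_antisymm
  · exact fun f hf => ⟨_, hf.2, inversion_inversion m f⟩
  · refine le_inf ?_ ?_
    · rw [ZhPlus_eq_range]
      rintro _ ⟨_, ⟨f, rfl⟩, rfl⟩
      exact inversion_ev_mem_Zh m f
    · rintro _ ⟨f, hf, rfl⟩
      rwa [Submodule.mem_comap, inversion_inversion]

/-! ### Products of the spaces -/

theorem ZhPlus_mul_ZhPlus_le : ZhPlus * ZhPlus ≤ ZhPlus :=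
  Submodule.mul_le.2 fun _ hf _ hg => ZhPoly.mul_mem hf hg

theorem HPlus_le_ZhPlus : HPlus ≤ ZhPlus := inf_le_right

theorem one_mem_HPlus : 1 ∈ HPlus := by
  rw [← map_one ev, ev_mem_HPlus_iff]
  simp [lap_apply]

theorem le_HPlus_mul (M : Submodule ℂ Fun) : M ≤ HPlus * M := fun f hf => by
  simpa using Submodule.mul_mem_mul one_mem_HPlus hf

theorem HPlus_mul_HPlus : HPlus * HPlus = ZhPlus := by
  refine le_antisymm ((mul_le_mul' HPlus_le_ZhPlus HPlus_le_ZhPlus).trans ZhPlus_mul_ZhPlus_le) ?_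
  rw [ZhPlus_eq_range]
  rintro _ ⟨f, rfl⟩
  change ev f ∈ _
  induction f using MvPolynomial.induction_on' with
  | add f g hf hg => rw [map_add]; exact add_mem hf hg
  | monomial m c =>
    -- Split by rows: each term of `□` differentiates once in each row, so a polynomial in a single
    -- row is harmonic.
    have h : monomial m c = c • ((X (0, 0) ^ m (0, 0) * X (0, 1) ^ m (0, 1)) *
        (X (1, 0) ^ m (1, 0) * X (1, 1) ^ m (1, 1))) := by
      rw [monomial_eq, smul_eq_C_mul, Finsupp.prod_fintype _ _ (by simp)]
      simp [Fintype.prod_prod_type, Fin.prod_univ_two]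
    rw [h, map_smul, map_mul]
    refine Submodule.smul_mem _ _ (Submodule.mul_mem_mul ?_ ?_) <;>
    · rw [ev_mem_HPlus_iff]
      simp [lap_apply, Derivation.leibniz, Derivation.leibniz_pow, pderiv_X]

theorem HPlus_mul_ZhPlus : HPlus * ZhPlus = ZhPlus :=
  le_antisymm ((mul_le_mul' HPlus_le_ZhPlus le_rfl).trans ZhPlus_mul_ZhPlus_le) (le_HPlus_mul _)

/-- A coordinate sends `(L, k)` to `(L + 1, k)` and `(L - 1, k + 1)`; both moves preserve `k ≥ -(L +
1)`. -/
theorem ZhPlus_mul_I2Plus_le : ZhPlus * I2Plus ≤ I2Plus := by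
  have hX : ∀ i, I2Plus ≤ I2Plus.comap (LinearMap.mulLeft ℂ (ev (X i))) := fun i => by
    refine spanT_le fun q r p k hk => ?_
    obtain ⟨v, hv, _, ⟨w, hw, rfl⟩, h⟩ := Submodule.mem_sup.1 (X_mul_tPoly_mem i q r p)
    rw [Submodule.mem_comap, LinearMap.mulLeft_apply, ← mul_assoc, ← map_mul, ← h, map_add, add_mul]
    push_cast at hk
    refine add_mem (ev_mul_zpow_mem_spanT hv fun l hl => by lia) ?_
    have := ev_mul_zpow_mem_spanT (P := fun L k => -((L : ℤ) + 1) ≤ k) (k := k + 1) hw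
      fun l hl => by lia
    rw [N_zpow_add, zpow_one] at this
    rw [LinearMap.mulLeft_apply, map_mul, ev_detPoly, mul_assoc, mul_left_comm, mul_comm N]
    exact this
  rw [Submodule.mul_le, ZhPlus_eq_range]
  rintro _ ⟨f, rfl⟩
  change ∀ g ∈ _, ev f * g ∈ _
  induction f using MvPolynomial.induction_on with
  | C a =>
    intro g hg
    have : ev (C a) * g = a • g := by
      rw [ev, aeval_C, Algebra.smul_def]
    rw [this]
    exact I2Plus.smul_mem _ hg
  | add f g hf hg => intro h hh; rw [map_add, add_mul]; exact add_mem (hf h hh) (hg h hh)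
  | mul_X f i hf => intro g hg; rw [map_mul, mul_assoc]; exact hf _ (hX i hg)

theorem spanT_mono {P P' : ℕ → ℤ → Prop} (h : ∀ L k, P L k → P' L k) : spanT P ≤ spanT P' :=
  Submodule.span_mono <| by
    rintro _ ⟨L, p, q, k, hP, rfl⟩
    exact ⟨L, p, q, k, h _ _ hP, rfl⟩

theorem N_pow_mem_ZhPlus (n : ℕ) : N ^ n ∈ ZhPlus := by
  rw [← ev_detPoly, ← map_pow]
  exact ev_mem_ZhPlus _

theorem HMinus_mul_ZhPlus : HMinus * ZhPlus = I2Plus := by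
  apply le_antisymm
  · rw [mul_comm, HMinus_eq_spanT]
    refine (mul_le_mul' le_rfl (spanT_mono fun L k hk => ?_)).trans ZhPlus_mul_I2Plus_le
    exact hk.ge
  · refine spanT_le fun q r p k hk => ?_
    obtain ⟨n, rfl⟩ : ∃ n : ℕ, k = -(((q + r : ℕ) : ℤ) + 1) + n :=
      ⟨(k + (((q + r : ℕ) : ℤ) + 1)).toNat, by lia⟩
    rw [N_zpow_add, ← mul_assoc, zpow_natCast, HMinus_eq_spanT]
    refine Submodule.mul_mem_mul (ev_mul_zpow_mem_spanT (tPoly_mem q r p) fun l hl => ?_)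
      (N_pow_mem_ZhPlus n)
    lia

theorem HPlus_mul_ZhZero : HPlus * ZhZero = I2Plus := by
  apply le_antisymm
  · refine (mul_le_mul' HPlus_le_ZhPlus (spanT_mono fun L k hk => ?_)).trans ZhPlus_mul_I2Plus_le
    exact hk.1
  · refine spanT_le fun q r p k hk => ?_
    rcases le_or_gt k (-1) with h | h
    · exact le_HPlus_mul _ (ev_mul_zpow_mem_spanT (tPoly_mem q r p) fun l hl => by lia)
    -- For `k ≥ 0`, write the polynomial `t N^(k+1)` as a sum of products of two harmonic ones and
    -- let the second factor absorb `N⁻¹`, which puts it in `Zh⁰`.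
    · obtain ⟨n, rfl⟩ : ∃ n : ℕ, k = n + (-1 : ℤ) := ⟨(k + 1).toNat, by lia⟩
      rw [N_zpow_add, zpow_natCast, ← mul_assoc]
      have h1 : ev (tPoly q r p) * N ^ n ∈ HPlus * HPlus := by
        rw [HPlus_mul_HPlus]
        exact ZhPoly.mul_mem (ev_mem_ZhPlus _) (N_pow_mem_ZhPlus n)
      have h2 : HPlus ≤ ZhZero.comap (LinearMap.mulRight ℂ (N ^ (-1 : ℤ))) := by
        conv_lhs => rw [HPlus_eq_spanT]
        refine spanT_le ?_
        rintro q r p k rfl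
        rw [zpow_zero, mul_one]
        exact ev_mul_zpow_mem_spanT (tPoly_mem q r p) fun l hl => by lia
      have h3 : HPlus * HPlus ≤
          (HPlus * ZhZero).comap (LinearMap.mulRight ℂ (N ^ (-1 : ℤ))) :=
        Submodule.mul_le.2 fun f hf g hg => by
          rw [Submodule.mem_comap, LinearMap.mulRight_apply, mul_assoc]
          exact Submodule.mul_mem_mul hf (h2 hg)
      exact h3 h1

theorem range_mult₂ (A B : Submodule ℂ Fun) : LinearMap.range (mult₂ A B) = A * B := by
  rw [← Submodule.mulMap_range, Submodule.mulMap_eq_mul'_comp_mapIncl]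
  rfl

theorem range_mult₃ (A B C : Submodule ℂ Fun) : LinearMap.range (mult₃ A B C) = A * B * C := by
  rw [mult₃, LinearMap.range_comp, TensorProduct.range_map, range_mult₂, Submodule.range_subtype]
  generalize A * B = D
  rw [← Submodule.mulMap_range, Submodule.mulMap_eq_mul'_comp_mapIncl, LinearMap.range_comp,
    TensorProduct.range_mapIncl]

end ComplexQuaternion

end

open ComplexQuaternion

theorem mainTheorem7 :
    (LinearMap.range (mult₃ HPlus HPlus HPlus) = ZhPlus ∧
      LinearMap.range (mult₂ HPlus ZhPlus) = ZhPlus) ∧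
    (LinearMap.range (mult₃ HMinus HMinus HMinus) = ZhMinus 2 ∧
      LinearMap.range (mult₂ HMinus (ZhMinus 1)) = ZhMinus 2) ∧
    (LinearMap.range (mult₃ HPlus HPlus HMinus) = I2Plus ∧
      LinearMap.range (mult₂ HMinus ZhPlus) = I2Plus ∧
      LinearMap.range (mult₂ HPlus ZhZero) = I2Plus) ∧
    (LinearMap.range (mult₃ HMinus HMinus HPlus) = I2Minus ∧
      LinearMap.range (mult₂ HPlus (ZhMinus 1)) = I2Minus ∧
      LinearMap.range (mult₂ HMinus ZhZero) = I2Minus) := by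
  simp only [range_mult₂, range_mult₃]
  -- The four identities below are transported by inversion: weight 0 on harmonic factors, 1 on
  -- `Zh⁺` and `Zh⁰`, and `m + n + 1` on products.
  have hMM : HMinus * HMinus = ZhMinus 1 := by
    rw [ZhMinus_eq_map, ← HPlus_mul_HPlus, map_inversion_mul 0 0, HMinus_eq_map]
  have hM1 : HMinus * ZhMinus 1 = ZhMinus 2 := by
    rw [ZhMinus_eq_map, ZhMinus_eq_map, ← HPlus_mul_ZhPlus, map_inversion_mul 0 1, HMinus_eq_map,
      HPlus_mul_ZhPlus]
  have hP1 : HPlus * ZhMinus 1 = I2Minus := by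
    rw [← map_inversion_I2Plus, ← HMinus_mul_ZhPlus, map_inversion_mul 0 1, map_inversion_HMinus,
      ZhMinus_eq_map]
  have hM0 : HMinus * ZhZero = I2Minus := by
    rw [← map_inversion_I2Plus, ← HPlus_mul_ZhZero, map_inversion_mul 0 1, map_inversion_ZhZero,
      HMinus_eq_map]
  refine ⟨⟨?_, HPlus_mul_ZhPlus⟩, ⟨?_, hM1⟩, ⟨?_, HMinus_mul_ZhPlus, HPlus_mul_ZhZero⟩, ?_, hP1, hM0⟩
  · rw [HPlus_mul_HPlus, mul_comm, HPlus_mul_ZhPlus]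
  · rw [hMM, mul_comm, hM1]
  · rw [HPlus_mul_HPlus, mul_comm, HMinus_mul_ZhPlus]
  · rw [hMM, mul_comm, hP1]
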